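/- Let $G$ be a locally compact second countable (Hausdorff) abelian group with Haar measure $m_G$. A \emph{strong F\o lner sequence} in $G$ is an increasing sequence $\mathcal F=(F_n)_{n\in\mathbb N}$ of compact sets with $\bigcup_n F_n=G$ such that $m_G(F_n+K)/m_G(F_n)\to 1$ for every nonempty compact $K\subset G$, and such that $m_G\big(\bigcap_{u\in U}(F_n-u)\big)/m_G(F_n)\to 1$ for some identity neighborhood $U\subset G$. For a set $Q\subset G$ put $$d_{\mathcal F}(Q)=\limsup_{n\to\infty}\frac{|Q\cap F_n|}{m_G(F_n)}\in[0,+\infty].$$ Let $H$ be a locally compact second countable (Hausdorff) abelian group with Haar measure $m_H$, and let $(G,H;\Gamma)$ be a cut-and-project scheme: $\Gamma<G\times H$ is a lattice (a discrete subgroup of finite covolume) such that $\operatorname{proj}_G|_\Gamma$ is injective and $\operatorname{proj}_H(\Gamma)$ is dense in $H$. Let $\operatorname{covol}_{G\times H}(\Gamma)$ be the measure of a fundamental domain of $\Gamma$ with respect to $m_G\otimes m_H$. Call a subset of $H$ \emph{Jordan measurable} if its topological boundary is $m_H$-null. Let $W\subset H$ be a \emph{window}, i.e. a relatively compact Jordan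 measurable set with $0<m_H(W)<+\infty$, and suppose that $W-W$ is Jordan measurable. Put $P=\operatorname{proj}_G\big(\Gamma\cap(G\times W)\big)\subset G$, and let $W^o$ be the interior of $W$. Then for every strong F\o lner sequence $\mathcal F$ in $G$, $$d_{\mathcal F}(P)=\operatorname{covol}_{G\times H}(\Gamma)^{-1}\cdot m_H(W)$$ and $$\operatorname{covol}_{G\times H}(\Gamma)^{-1}\cdot m_H(W^o-W^o)\le d_{\mathcal F}(P-P)\le \operatorname{covol}_{G\times H}(\Gamma)^{-1}\cdot m_H(W-W).$$ In particular, when $H=\mathbb R$, with Haar measure $m_{\mathbb R}$, and $W=[a,b]\subset\mathbb R$ with $a<b$, $$d_{\mathcal F}(P-P)=2\cdot\operatorname{covol}_{G\times\mathbb R}(\Gamma)^{-1}\cdot m_{\mathbb R}(W)=2\cdot d_{\mathcal F}(P).$$ -/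

import Mathlib

open MeasureTheory Filter Topology Set
open scoped ENNReal Pointwise

namespace CutProject

/-- A sequence of sets `F n` in an abelian group `G` (with Haar measure `m`) is a strong Følner
sequence if it is an increasing exhaustion of `G` by compact sets which is asymptotically invariant
under thickening by compact sets, and which is `U`-adapted for some identity neighborhood `U`.
(Taking `K = {0, g}` in `thickening` shows that such a sequence is Følner.) -/
structure IsStrongFolner {G : Type*} [AddCommGroup G] [TopologicalSpace G] [MeasurableSpace G]
    (m : Measure G) (F : ℕ → Set G) : Prop where
  compact : ∀ n, IsCompact (F n)
  increasing : Monotone F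
  exhaustion : ⋃ n, F n = univ
  thickening : ∀ K : Set G, IsCompact K → K.Nonempty →
    Tendsto (fun n => m (F n + K) / m (F n)) atTop (𝓝 1)
  adapted : ∃ U ∈ 𝓝 (0 : G),
    Tendsto (fun n => m (⋂ u ∈ U, (F n - {u})) / m (F n)) atTop (𝓝 1)

/-- The asymptotic density of `P` along `F`: the upper limit of `|P ∩ F n| / m (F n)`, as an
extended nonnegative real. -/
noncomputable def asymptoticDensity {G : Type*} [MeasurableSpace G]
    (m : Measure G) (F : ℕ → Set G) (P : Set G) : ℝ≥0∞ :=
  limsup (fun n => ((P ∩ F n).encard : ℝ≥0∞) / m (F n)) atTop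

/-- A set is Jordan measurable if its topological boundary is a null set. -/
def IsJordanMeasurable {H : Type*} [TopologicalSpace H] [MeasurableSpace H]
    (m : Measure H) (W : Set H) : Prop :=
  m (frontier W) = 0

/-- A window is a relatively compact Jordan measurable set of positive finite measure. -/
structure IsWindow {H : Type*} [TopologicalSpace H] [MeasurableSpace H]
    (m : Measure H) (W : Set H) : Prop where
  relativelyCompact : IsCompact (closure W)
  jordan : IsJordanMeasurable m W
  measure_pos : 0 < m W
  measure_lt_top : m W < ∞

/-- A lattice is a discrete subgroup admitting a fundamental domain of finite measure. -/
structure IsLattice {A : Type*} [AddCommGroup A] [TopologicalSpace A] [MeasurableSpace A]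
    (m : Measure A) (Γ : AddSubgroup A) : Prop where
  discrete : DiscreteTopology Γ
  finite_covolume : ∃ D : Set A, IsAddFundamentalDomain Γ D m ∧ m D < ∞

/-- The covolume of a lattice `Γ < G × H` with respect to the product of the Haar measures, that
is, the measure of a fundamental domain. -/
noncomputable def covol {G H : Type*} [AddCommGroup G] [AddCommGroup H]
    [MeasurableSpace G] [MeasurableSpace H] (mG : Measure G) (mH : Measure H)
    (Γ : AddSubgroup (G × H)) : ℝ≥0∞ :=
  addCovolume Γ (G × H) (mG.prod mH)

/-- `(G, H; Γ)` is a cut-and-project scheme: `Γ` is a lattice in `G × H` that projects injectively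
to `G` and densely to `H`. -/
structure IsCutAndProjectScheme {G H : Type*} [AddCommGroup G] [AddCommGroup H]
    [TopologicalSpace G] [TopologicalSpace H] [MeasurableSpace G] [MeasurableSpace H]
    (mG : Measure G) (mH : Measure H) (Γ : AddSubgroup (G × H)) : Prop where
  lattice : IsLattice (mG.prod mH) Γ
  injective : InjOn Prod.fst (Γ : Set (G × H))
  dense : Dense (Prod.snd '' (Γ : Set (G × H)))

/-- The cut-and-project set `proj_G (Γ ∩ (G × W))`. -/
def cutAndProjectSet {G H : Type*} [AddCommGroup G] [AddCommGroup H]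
    (Γ : AddSubgroup (G × H)) (W : Set H) : Set G :=
  Prod.fst '' ((Γ : Set (G × H)) ∩ (univ ×ˢ W))

end CutProject

universe u v

open CutProject

/-!
Averaging the number of points of a coset `y + Γ` in a set `E` over a fundamental domain gives the
measure of `E`. By density of the projection to `H`, every coset meets `C × V` for some compact
`C`, however small the identity neighborhood `V` of `H` is. Translating by a point of `C × V`
compares the counts over any two cosets, at the price of enlarging `F × K` to `(F + C) × (K + V)`.
Comparing with the average, the number of points of `Γ` in `F × K` is squeezed between products of
measures; the thickening by `C` does not matter along a Følner family, and shrinking `V` is harmless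
when the boundary of the window is null. For the difference set, density of the projection to `H`
again shows that `P - P` contains the cut-and-project set of `W° - W°`, and it is contained in that
of `W - W`.
-/

namespace CutProject

universe w

section CosetCount

variable {A : Type*} [AddCommGroup A] {Γ : AddSubgroup A} {E E' S : Set A}

/-- The number of points of the coset `y + Γ` which lie in `E`. The points are indexed by `Γ`, and
the count is an extended nonnegative real so that it can be integrated in `y`. -/
noncomputable def cosetCount (Γ : AddSubgroup A) (E : Set A) (y : A) : ℝ≥0∞ :=
  ({γ : Γ | y + γ ∈ E}.encard : ℝ≥0∞)

/-- `E` is a packing set for `Γ`: its translates by distinct elements of `Γ` are disjoint. -/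
def IsPacking (Γ : AddSubgroup A) (E : Set A) : Prop :=
  ∀ x ∈ E, ∀ y ∈ E, x - y ∈ Γ → x = y

/-- `S` is a covering set for `Γ`: it meets every coset, so its translates by `Γ` cover the
group. -/
def IsCovering (Γ : AddSubgroup A) (S : Set A) : Prop :=
  ∀ y : A, ∃ γ : Γ, y + γ ∈ S

lemma cosetCount_eq_tsum (Γ : AddSubgroup A) (E : Set A) (y : A) :
    cosetCount Γ E y = ∑' γ : Γ, E.indicator 1 (y + (γ : A)) := by
  rw [cosetCount, ← ENNReal.tsum_set_one, tsum_subtype {γ : Γ | y + γ ∈ E} (fun _ => (1 : ℝ≥0∞))]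
  rfl

lemma IsPacking.vadd (hE : IsPacking Γ E) (x : A) : IsPacking Γ (x +ᵥ E) := by
  rintro _ ⟨p, hp, rfl⟩ _ ⟨q, hq, rfl⟩ hpq
  simp only [vadd_eq_add, add_sub_add_left_eq_sub] at hpq
  rw [hE p hp q hq hpq]

lemma IsPacking.cosetCount_le_one (hE : IsPacking Γ E) (y : A) : cosetCount Γ E y ≤ 1 := by
  have hsub : {γ : Γ | y + γ ∈ E}.Subsingleton := fun γ hγ γ' hγ' => by
    have hdiff : (y + γ : A) - (y + γ') ∈ Γ := by
      rw [add_sub_add_left_eq_sub]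
      exact (γ - γ').2
    exact Subtype.ext (add_left_cancel (hE _ hγ _ hγ' hdiff))
  simpa only [cosetCount, ENat.toENNReal_one] using
    ENat.toENNReal_le.2 (encard_le_one_iff_subsingleton.2 hsub)

lemma IsCovering.cosetCount_le_cosetCount (hS : IsCovering Γ S) (hE : E + S ⊆ E') (y y' : A) :
    cosetCount Γ E y ≤ cosetCount Γ E' y' := by
  obtain ⟨δ, hδ⟩ := hS (y' - y)
  refine ENat.toENNReal_le.2 ?_
  rw [← (add_left_injective δ).encard_image]
  refine encard_le_encard ?_
  rintro _ ⟨γ, hγ, rfl⟩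
  have hshift : y' + ((γ + δ : Γ) : A) = (y + γ) + (y' - y + δ) := by push_cast; abel
  exact mem_ofPred_eq ▸ hshift ▸ hE (add_mem_add hγ hδ)

variable [MeasurableSpace A] [MeasurableAdd A] {μ : Measure A} [μ.IsAddLeftInvariant] [Countable Γ]
  {D : Set A}

lemma setLIntegral_cosetCount (hD : IsAddFundamentalDomain Γ D μ) (hE : MeasurableSet E) :
    ∫⁻ y in D, cosetCount Γ E y ∂μ = μ E := by
  simp_rw [cosetCount_eq_tsum]
  rw [lintegral_tsum]
  · rw [← lintegral_indicator_one hE, hD.lintegral_eq_tsum', ← (Equiv.neg Γ).tsum_eq]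
    refine tsum_congr fun γ => lintegral_congr fun y => ?_
    simp [AddSubgroup.vadd_def, add_comm]
  · intro γ
    exact ((measurable_one.indicator hE).comp (measurable_add_const _)).aemeasurable

lemma IsPacking.exists_add_mem_of_measure_lt (hE : IsPacking Γ E)
    (hD : IsAddFundamentalDomain Γ D μ) (hEm : MeasurableSet E) {L : Set A}
    (hL : MeasurableSet L) (hlt : μ.restrict D Lᶜ < μ E) :
    ∃ y ∈ L, ∃ γ : Γ, y + γ ∈ E := by
  by_contra! hL_disjoint
  have hcount : ∀ y, cosetCount Γ E y ≤ Lᶜ.indicator 1 y := fun y => by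
    by_cases hy : y ∈ L
    · simp [cosetCount, hL_disjoint y hy]
    · simpa [hy] using hE.cosetCount_le_one y
  refine hlt.not_ge ?_
  calc μ E = ∫⁻ y in D, cosetCount Γ E y ∂μ := (setLIntegral_cosetCount hD hEm).symm
    _ ≤ ∫⁻ y in D, Lᶜ.indicator 1 y ∂μ := lintegral_mono hcount
    _ = μ.restrict D Lᶜ := lintegral_indicator_one hL.compl

lemma IsCovering.measure_mul_cosetCount_le (hS : IsCovering Γ S)
    (hD : IsAddFundamentalDomain Γ D μ) (hE : E + S ⊆ E') (hE' : MeasurableSet E') (y : A) :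
    μ D * cosetCount Γ E y ≤ μ E' := by
  rw [← setLIntegral_cosetCount hD hE', mul_comm, ← setLIntegral_const]
  exact lintegral_mono fun y' => hS.cosetCount_le_cosetCount hE y y'

lemma IsCovering.le_measure_mul_cosetCount (hS : IsCovering Γ S)
    (hD : IsAddFundamentalDomain Γ D μ) (hE : E + S ⊆ E') (hEm : MeasurableSet E) (y : A) :
    μ E ≤ μ D * cosetCount Γ E' y := by
  rw [← setLIntegral_cosetCount hD hEm, mul_comm, ← setLIntegral_const]
  exact lintegral_mono fun y' => hS.cosetCount_le_cosetCount hE y' y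

end CosetCount

section Lattice

variable {A : Type*} [AddCommGroup A] [TopologicalSpace A] {Γ : AddSubgroup A}

lemma exists_isCompact_isPacking [IsTopologicalAddGroup A] [LocallyCompactSpace A]
    [DiscreteTopology Γ] : ∃ M ∈ 𝓝 (0 : A), IsCompact M ∧ IsPacking Γ M := by
  obtain ⟨O, hO, hOΓ⟩ := nhds_inter_eq_singleton_of_mem_discrete (s := (Γ : Set A)) ⟨‹_›⟩ Γ.zero_mem
  obtain ⟨V, hV, hVO⟩ := exists_nhds_half_neg hO
  obtain ⟨M, hM, hMV, hMc⟩ := LocallyCompactSpace.local_compact_nhds 0 V hV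
  refine ⟨M, hM, hMc, fun x hx y hy hxy => sub_eq_zero.1 ?_⟩
  exact mem_singleton_iff.1 (hOΓ ▸ ⟨hVO x (hMV hx) y (hMV hy), hxy⟩)

variable [SecondCountableTopology A] [MeasurableSpace A] {μ : Measure A}

lemma IsLattice.countable (h : IsLattice μ Γ) : Countable Γ :=
  have := h.discrete
  countable_of_Lindelof_of_discrete

variable [IsTopologicalAddGroup A] [BorelSpace A]

lemma IsLattice.addCovolume_eq [μ.IsAddLeftInvariant] (h : IsLattice μ Γ) {D : Set A}
    (hD : IsAddFundamentalDomain Γ D μ) : addCovolume Γ A μ = μ D :=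
  have := h.countable
  hD.covolume_eq_volume μ

lemma IsLattice.addCovolume_ne_top [μ.IsAddLeftInvariant] (h : IsLattice μ Γ) :
    addCovolume Γ A μ ≠ ∞ := by
  obtain ⟨D, hD, hD_lt_top⟩ := h.finite_covolume
  exact h.addCovolume_eq hD ▸ hD_lt_top.ne

lemma IsLattice.addCovolume_ne_zero [μ.IsAddLeftInvariant] [NeZero μ] (h : IsLattice μ Γ) :
    addCovolume Γ A μ ≠ 0 := by
  have := h.countable
  obtain ⟨D, hD, -⟩ := h.finite_covolume
  exact h.addCovolume_eq hD ▸ hD.measure_ne_zero (NeZero.ne μ)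

theorem IsLattice.exists_isCompact_isCovering [T2Space A] [LocallyCompactSpace A]
    [μ.IsAddHaarMeasure] (h : IsLattice μ Γ) : ∃ L : Set A, IsCompact L ∧ IsCovering Γ L := by
  have := h.discrete
  have := h.countable
  obtain ⟨D, hD, hD_lt_top⟩ := h.finite_covolume
  obtain ⟨M, hM, hMc, hM_packing⟩ := exists_isCompact_isPacking (Γ := Γ)
  have : IsFiniteMeasure (μ.restrict D) := ⟨by simpa using hD_lt_top⟩
  obtain ⟨L, -, hL, hDL⟩ := MeasurableSet.univ.exists_isCompact_sdiff_lt
    (measure_ne_top (μ.restrict D) univ) (Measure.measure_pos_of_mem_nhds μ hM).ne'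
  refine ⟨L - M, by simpa only [sub_eq_add_neg] using hL.add hMc.neg, fun x => ?_⟩
  obtain ⟨y, hy, γ, m, hm, hmγ⟩ := (hM_packing.vadd x).exists_add_mem_of_measure_lt hD
    (hMc.vadd x).measurableSet hL.measurableSet
    (by rwa [measure_vadd, compl_eq_univ_sdiff])
  have hxm : x + m = y + γ := hmγ
  refine ⟨-γ, y, hy, m, hm, ?_⟩
  rw [AddSubgroup.coe_neg, ← sub_eq_add_neg, sub_eq_sub_iff_add_eq_add, hxm]

end Lattice

section Covering

lemma prod_add_prod_subset_prod {G H : Type*} [Add G] [Add H] {E C E' : Set G} {K V U : Set H}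
    (hE : E + C ⊆ E') (hK : K + V ⊆ U) : E ×ˢ K + C ×ˢ V ⊆ E' ×ˢ U := by
  rintro _ ⟨p, hp, q, hq, rfl⟩
  exact ⟨hE (add_mem_add hp.1 hq.1), hK (add_mem_add hp.2 hq.2)⟩

variable {G H : Type*} [AddCommGroup G] [AddCommGroup H] [TopologicalSpace G] [TopologicalSpace H]
  [ContinuousAdd G] [ContinuousAdd H] {Γ : AddSubgroup (G × H)}

lemma IsCovering.exists_isCompact_prod {L : Set (G × H)} (hLΓ : IsCovering Γ L) (hL : IsCompact L)
    (hΓ : Dense (Prod.snd '' (Γ : Set (G × H)))) {V : Set H} (hV : V ∈ 𝓝 (0 : H)) :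
    ∃ C : Set G, IsCompact C ∧ IsCovering Γ (C ×ˢ V) := by
  let O : Γ → Set H := fun γ => (· + γ.1.2) ⁻¹' interior V
  have hO : ∀ γ, IsOpen (O γ) := fun γ => isOpen_interior.preimage (continuous_add_const _)
  have hcover : Prod.snd '' L ⊆ ⋃ γ, O γ := by
    intro h _
    obtain ⟨_, ⟨γ, hγ, rfl⟩, hγV⟩ := hΓ.exists_mem_open
      (isOpen_interior.preimage (continuous_const_add h))
      ⟨-h, by simpa using mem_interior_iff_mem_nhds.2 hV⟩
    exact mem_iUnion.2 ⟨⟨γ, hγ⟩, hγV⟩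
  obtain ⟨s, hs⟩ := (hL.image continuous_snd).elim_finite_subcover O hO hcover
  refine ⟨Prod.fst '' L + (fun γ : Γ => γ.1.1) '' s,
    (hL.image continuous_fst).add (s.finite_toSet.image _).isCompact, fun y => ?_⟩
  obtain ⟨γ, hγ⟩ := hLΓ y
  obtain ⟨δ, hδ, hδV⟩ := mem_iUnion₂.1 (hs (mem_image_of_mem _ hγ))
  refine ⟨γ + δ, ?_, ?_⟩ <;> rw [AddSubgroup.coe_add, ← add_assoc]
  · exact add_mem_add (mem_image_of_mem _ hγ) (mem_image_of_mem _ hδ)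
  · exact interior_subset hδV

end Covering

section CutAndProjectSet

variable {G H : Type*} [AddCommGroup G] [AddCommGroup H] {Γ : AddSubgroup (G × H)}

lemma cutAndProjectSet_mono {W W' : Set H} (h : W ⊆ W') :
    cutAndProjectSet Γ W ⊆ cutAndProjectSet Γ W' :=
  image_mono (inter_subset_inter_right _ (prod_mono_right h))

lemma cutAndProjectSet_sub_subset (W W' : Set H) :
    cutAndProjectSet Γ W - cutAndProjectSet Γ W' ⊆ cutAndProjectSet Γ (W - W') := by
  rintro _ ⟨_, ⟨γ, ⟨hγ, -, hW⟩, rfl⟩, _, ⟨γ', ⟨hγ', -, hW'⟩, rfl⟩, rfl⟩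
  exact ⟨γ - γ', ⟨Γ.sub_mem hγ hγ', mem_univ _, sub_mem_sub hW hW'⟩, rfl⟩

lemma cutAndProjectSet_sub_subset_sub [TopologicalSpace H] [ContinuousAdd H]
    (hΓ : Dense (Prod.snd '' (Γ : Set (G × H)))) {U U' : Set H} (hU : IsOpen U)
    (hU' : IsOpen U') :
    cutAndProjectSet Γ (U - U') ⊆ cutAndProjectSet Γ U - cutAndProjectSet Γ U' := by
  rintro _ ⟨γ, ⟨hγ, -, w, hw, w', hw', hww'⟩, rfl⟩
  have hγw' : γ.2 + w' = w := by rw [← hww', sub_add_cancel]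
  obtain ⟨_, ⟨δ, hδ, rfl⟩, hγδU, hδU'⟩ := hΓ.exists_mem_open
    ((hU.preimage (continuous_const_add γ.2)).inter hU') ⟨w', by simpa [hγw'] using hw, hw'⟩
  exact ⟨(γ + δ).1, ⟨γ + δ, ⟨Γ.add_mem hγ hδ, mem_univ _, hγδU⟩, rfl⟩,
    δ.1, ⟨δ, ⟨hδ, mem_univ _, hδU'⟩, rfl⟩, by simp⟩

lemma encard_cutAndProjectSet_inter (hΓ : InjOn Prod.fst (Γ : Set (G × H))) (W : Set H)
    (E : Set G) :
    ((cutAndProjectSet Γ W ∩ E).encard : ℝ≥0∞) = cosetCount Γ (E ×ˢ W) 0 := by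
  have hinj : Function.Injective (fun γ : Γ => (γ : G × H).1) :=
    fun γ γ' hγγ' => Subtype.ext (hΓ γ.2 γ'.2 hγγ')
  rw [cosetCount, ← hinj.encard_image]
  congr 2
  ext g
  constructor
  · rintro ⟨⟨γ, ⟨hγ, -, hγW⟩, rfl⟩, hγE⟩
    exact ⟨⟨γ, hγ⟩, by simpa using ⟨hγE, hγW⟩, rfl⟩
  · rintro ⟨γ, hγ, rfl⟩
    simp only [zero_add, mem_ofPred_eq, mem_prod] at hγ
    exact ⟨⟨γ, ⟨γ.2, mem_univ _, hγ.2⟩, rfl⟩, hγ.1⟩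

end CutAndProjectSet

section Erosion

variable {G : Type*} [AddCommGroup G]

/-- The erosion of `E` by `C`: the set of points `x` with `x + C ⊆ E`. -/
def erosion (E C : Set G) : Set G :=
  {x | ∀ c ∈ C, x + c ∈ E}

lemma erosion_add_subset (E C : Set G) : erosion E C + C ⊆ E := by
  rintro _ ⟨x, hx, c, hc, rfl⟩
  exact hx c hc

lemma erosion_subset_of_zero_mem {C : Set G} (hC : 0 ∈ C) (E : Set G) : erosion E C ⊆ E :=
  fun x hx => add_zero x ▸ hx 0 hC

lemma erosion_eq_iInter_preimage (E C : Set G) : erosion E C = ⋂ c ∈ C, (· + c) ⁻¹' E := by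
  ext x
  simp [erosion]

lemma erosion_eq_iInter_sub_singleton (E C : Set G) : erosion E C = ⋂ c ∈ C, (E - {c}) := by
  ext x
  simp [erosion, sub_eq_iff_eq_add]

lemma isClosed_erosion [TopologicalSpace G] [ContinuousAdd G] {E : Set G} (hE : IsClosed E)
    (C : Set G) : IsClosed (erosion E C) := by
  rw [erosion_eq_iInter_preimage]
  exact isClosed_biInter fun c _ => hE.preimage (continuous_add_const c)

lemma iInter_preimage_erosion_subset {C U : Set G} {s : Finset G}
    (hC : C ⊆ ⋃ c ∈ s, c +ᵥ U) (E : Set G) :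
    ⋂ c ∈ s, (· + c) ⁻¹' erosion E U ⊆ erosion E C := by
  intro x hx c hc
  obtain ⟨c', hc', u, hu, rfl⟩ := mem_iUnion₂.1 (hC hc)
  simpa only [vadd_eq_add, add_assoc] using mem_iInter₂.1 hx c' hc' u hu

variable [MeasurableSpace G] [MeasurableAdd G] {m : Measure G} [m.IsAddLeftInvariant]

lemma measure_erosion_le {C : Set G} (hC : C.Nonempty) (E : Set G) : m (erosion E C) ≤ m E := by
  obtain ⟨c, hc⟩ := hC
  rw [← measure_preimage_add_right m c E]
  exact measure_mono fun x hx => hx c hc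

end Erosion

section AdaptedFolner

variable {G ι : Type*} [AddCommGroup G] [TopologicalSpace G] [MeasurableSpace G]

/-- The part of the strong Følner condition which governs densities, for a family of compact sets
indexed along an arbitrary filter: neither monotonicity nor exhaustion is required. -/
structure IsAdaptedFolner (m : Measure G) (l : Filter ι) (F : ι → Set G) : Prop where
  isCompact : ∀ i, IsCompact (F i)
  tendsto_thickening : ∀ K : Set G, IsCompact K → K.Nonempty →
    Tendsto (fun i => m (F i + K) / m (F i)) l (𝓝 1)
  exists_tendsto_erosion : ∃ U ∈ 𝓝 (0 : G),
    Tendsto (fun i => m (erosion (F i) U) / m (F i)) l (𝓝 1)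

lemma IsStrongFolner.isAdaptedFolner {m : Measure G} {F : ℕ → Set G} (hF : IsStrongFolner m F) :
    IsAdaptedFolner m atTop F where
  isCompact := hF.compact
  tendsto_thickening := hF.thickening
  exists_tendsto_erosion := by simpa only [erosion_eq_iInter_sub_singleton] using hF.adapted

namespace IsAdaptedFolner

variable {m : Measure G} {l : Filter ι} {F : ι → Set G}

lemma eventually_measure_ne_zero (hF : IsAdaptedFolner m l F) : ∀ᶠ i in l, m (F i) ≠ 0 := by
  have hlim := hF.tendsto_thickening {0} isCompact_singleton (singleton_nonempty 0)
  filter_upwards [hlim.eventually_ne one_ne_zero] with i hi hzero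
  simp [hzero] at hi

lemma tendsto_measure_div_self [IsFiniteMeasureOnCompacts m] (hF : IsAdaptedFolner m l F) :
    Tendsto (fun i => m (F i) / m (F i)) l (𝓝 1) := by
  refine tendsto_const_nhds.congr' ?_
  filter_upwards [hF.eventually_measure_ne_zero] with i hi
  exact (ENNReal.div_self hi (hF.isCompact i).measure_ne_top).symm

variable [IsTopologicalAddGroup G] [BorelSpace G] [m.IsAddLeftInvariant]
  [IsFiniteMeasureOnCompacts m]

lemma tendsto_measure_sdiff_preimage_add (hF : IsAdaptedFolner m l F) {T : ι → Set G}
    (hTm : ∀ i, MeasurableSet (T i)) (hTF : ∀ i, T i ⊆ F i)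
    (hT : Tendsto (fun i => m (T i) / m (F i)) l (𝓝 1)) (c : G) :
    Tendsto (fun i => m (F i \ (· + c) ⁻¹' T i) / m (F i)) l (𝓝 0) := by
  have hK : IsCompact ({0, -c} : Set G) := (toFinite _).isCompact
  have hlim : Tendsto (fun i => m (F i + {0, -c}) / m (F i) - m (T i) / m (F i)) l (𝓝 0) := by
    simpa only [tsub_self] using ENNReal.Tendsto.sub
      (hF.tendsto_thickening _ hK (insert_nonempty _ _)) hT (Or.inl ENNReal.one_ne_top)
  refine tendsto_of_tendsto_of_tendsto_of_le_of_le tendsto_const_nhds hlim (fun _ => zero_le) ?_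
  intro i
  have hF_subset : F i ⊆ F i + {0, -c} := fun x hx => ⟨x, hx, 0, by simp, add_zero x⟩
  have hT_subset : (· + c) ⁻¹' T i ⊆ F i + {0, -c} := fun x hx =>
    ⟨x + c, hTF i hx, -c, by simp, add_neg_cancel_right x c⟩
  have hT_ne_top : m ((· + c) ⁻¹' T i) ≠ ∞ :=
    measure_ne_top_of_subset hT_subset ((hF.isCompact i).add hK).measure_ne_top
  calc m (F i \ (· + c) ⁻¹' T i) / m (F i)
      ≤ m ((F i + {0, -c}) \ (· + c) ⁻¹' T i) / m (F i) := by gcongr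
    _ = (m (F i + {0, -c}) - m (T i)) / m (F i) := by
      rw [measure_sdiff hT_subset (measurable_add_const c (hTm i)).nullMeasurableSet hT_ne_top,
        measure_preimage_add_right]
    _ = m (F i + {0, -c}) / m (F i) - m (T i) / m (F i) :=
      ENNReal.sub_div fun hT_pos _ => (hT_pos.trans_le (measure_mono (hTF i))).ne'

lemma tendsto_measure_sdiff_iInter_preimage_add (hF : IsAdaptedFolner m l F) {T : ι → Set G}
    (hTm : ∀ i, MeasurableSet (T i)) (hTF : ∀ i, T i ⊆ F i)
    (hT : Tendsto (fun i => m (T i) / m (F i)) l (𝓝 1)) (s : Finset G) :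
    Tendsto (fun i => m (F i \ ⋂ c ∈ s, (· + c) ⁻¹' T i) / m (F i)) l (𝓝 0) := by
  have hsum : Tendsto (fun i => ∑ c ∈ s, m (F i \ (· + c) ⁻¹' T i) / m (F i)) l (𝓝 0) := by
    simpa only [Finset.sum_const_zero] using tendsto_finsetSum s fun c _ =>
      hF.tendsto_measure_sdiff_preimage_add hTm hTF hT c
  refine tendsto_of_tendsto_of_tendsto_of_le_of_le tendsto_const_nhds hsum (fun _ => zero_le) ?_
  intro i
  simp only [sdiff_iInter, div_eq_mul_inv, ← Finset.sum_mul]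
  gcongr
  exact measure_biUnion_finset_le _ _

theorem tendsto_measure_erosion_div [T2Space G] (hF : IsAdaptedFolner m l F) {C : Set G}
    (hC : IsCompact C) (hC_nonempty : C.Nonempty) :
    Tendsto (fun i => m (erosion (F i) C) / m (F i)) l (𝓝 1) := by
  obtain ⟨U, hU, hT⟩ := hF.exists_tendsto_erosion
  obtain ⟨s, -, hs⟩ := hC.elim_nhds_subcover (fun c => c +ᵥ U) fun c _ => by
    simpa using vadd_mem_nhds_vadd c hU
  have hloss := hF.tendsto_measure_sdiff_iInter_preimage_add
    (fun i => (isClosed_erosion (hF.isCompact i).isClosed U).measurableSet)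
    (fun i => erosion_subset_of_zero_mem (mem_of_mem_nhds hU) (F i)) hT s
  have hlower : Tendsto (fun i => m (F i) / m (F i) -
      m (F i \ ⋂ c ∈ s, (· + c) ⁻¹' erosion (F i) U) / m (F i)) l (𝓝 1) := by
    simpa only [tsub_zero] using
      ENNReal.Tendsto.sub hF.tendsto_measure_div_self hloss (Or.inl ENNReal.one_ne_top)
  refine tendsto_of_tendsto_of_tendsto_of_le_of_le hlower hF.tendsto_measure_div_self
    (fun i => ?_) (fun i => ENNReal.div_le_div_right (measure_erosion_le hC_nonempty _) _)
  refine tsub_le_iff_right.2 ?_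
  rw [← ENNReal.add_div]
  gcongr
  calc m (F i) ≤ m (F i ∩ ⋂ c ∈ s, (· + c) ⁻¹' erosion (F i) U) +
        m (F i \ ⋂ c ∈ s, (· + c) ⁻¹' erosion (F i) U) := measure_le_inter_add_sdiff m _ _
    _ ≤ m (erosion (F i) C) + m (F i \ ⋂ c ∈ s, (· + c) ⁻¹' erosion (F i) U) := by
      gcongr
      exact inter_subset_right.trans (iInter_preimage_erosion_subset hs (F i))

end IsAdaptedFolner

end AdaptedFolner

section Density

/-- The number of points of `P` in `E` per unit of volume of `E`. Its upper limit along a sequence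
of sets `E` is `asymptoticDensity`. -/
noncomputable def pointFrequency {G : Type*} [MeasurableSpace G] (m : Measure G) (P E : Set G) :
    ℝ≥0∞ :=
  ((P ∩ E).encard : ℝ≥0∞) / m E

lemma pointFrequency_mono {G : Type*} [MeasurableSpace G] {m : Measure G} {P Q : Set G}
    (h : P ⊆ Q) (E : Set G) : pointFrequency m P E ≤ pointFrequency m Q E :=
  ENNReal.div_le_div_right
    (ENat.toENNReal_le.2 (encard_le_encard (inter_subset_inter_left E h))) _

variable {G H ι : Type*} [AddCommGroup G] [TopologicalSpace G] [IsTopologicalAddGroup G]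
  [LocallyCompactSpace G] [SecondCountableTopology G] [MeasurableSpace G] [BorelSpace G]
  [AddCommGroup H] [TopologicalSpace H] [IsTopologicalAddGroup H] [LocallyCompactSpace H]
  [SecondCountableTopology H] [MeasurableSpace H] [BorelSpace H]
  {mG : Measure G} [mG.IsAddHaarMeasure] {mH : Measure H} [mH.IsAddHaarMeasure]
  {Γ : AddSubgroup (G × H)} {l : Filter ι} {F : ι → Set G} {W : Set H}

namespace IsCutAndProjectScheme

lemma covol_ne_zero (h : IsCutAndProjectScheme mG mH Γ) : covol mG mH Γ ≠ 0 :=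
  h.lattice.addCovolume_ne_zero

lemma covol_ne_top (h : IsCutAndProjectScheme mG mH Γ) : covol mG mH Γ ≠ ∞ :=
  h.lattice.addCovolume_ne_top

lemma le_covol_mul_pointFrequency (h : IsCutAndProjectScheme mG mH Γ) {C : Set G} {V K U : Set H}
    (hCV : IsCovering Γ (C ×ˢ V)) (hKU : K + V ⊆ U) (hK : MeasurableSet K) {E : Set G}
    (hE : IsClosed E) :
    mG (erosion E C) / mG E * mH K ≤
      covol mG mH Γ * pointFrequency mG (cutAndProjectSet Γ U) E := by
  have := h.lattice.countable
  obtain ⟨D, hD, -⟩ := h.lattice.finite_covolume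
  have hcount : mG (erosion E C) * mH K ≤ covol mG mH Γ * cosetCount Γ (E ×ˢ U) 0 := by
    rw [covol, h.lattice.addCovolume_eq hD, ← Measure.prod_prod]
    exact hCV.le_measure_mul_cosetCount hD
      (prod_add_prod_subset_prod (erosion_add_subset E C) hKU)
      ((isClosed_erosion hE C).measurableSet.prod hK) 0
  rw [pointFrequency, encard_cutAndProjectSet_inter h.injective, ← mul_div_assoc,
    ← ENNReal.mul_div_right_comm]
  gcongr

variable [T2Space G]

lemma covol_mul_pointFrequency_le (h : IsCutAndProjectScheme mG mH Γ) {C : Set G} {V K U : Set H}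
    (hCV : IsCovering Γ (C ×ˢ V)) (hC : IsCompact C) (hKU : K + V ⊆ U) (hU : MeasurableSet U)
    {E : Set G} (hE : IsCompact E) :
    covol mG mH Γ * pointFrequency mG (cutAndProjectSet Γ K) E ≤ mG (E + C) / mG E * mH U := by
  have := h.lattice.countable
  obtain ⟨D, hD, -⟩ := h.lattice.finite_covolume
  have hcount : covol mG mH Γ * cosetCount Γ (E ×ˢ K) 0 ≤ mG (E + C) * mH U := by
    rw [covol, h.lattice.addCovolume_eq hD, ← Measure.prod_prod]
    exact hCV.measure_mul_cosetCount_le hD (prod_add_prod_subset_prod subset_rfl hKU)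
      ((hE.add hC).measurableSet.prod hU) 0
  rw [pointFrequency, encard_cutAndProjectSet_inter h.injective, ← mul_div_assoc,
    ← ENNReal.mul_div_right_comm]
  gcongr

variable [T2Space H]

lemma exists_isCompact_isCovering_prod (h : IsCutAndProjectScheme mG mH Γ) {V : Set H}
    (hV : V ∈ 𝓝 (0 : H)) : ∃ C : Set G, IsCompact C ∧ IsCovering Γ (C ×ˢ V) := by
  obtain ⟨L, hL, hLΓ⟩ := h.lattice.exists_isCompact_isCovering
  exact hLΓ.exists_isCompact_prod hL h.dense hV

theorem limsup_pointFrequency_le [l.NeBot] (h : IsCutAndProjectScheme mG mH Γ)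
    (hF : IsAdaptedFolner mG l F) (hW : IsCompact (closure W)) :
    limsup (fun i => pointFrequency mG (cutAndProjectSet Γ W) (F i)) l ≤
      (covol mG mH Γ)⁻¹ * mH (closure W) := by
  rw [← ENNReal.mul_le_iff_le_inv h.covol_ne_zero h.covol_ne_top,
    ← ENNReal.limsup_const_mul_of_ne_top h.covol_ne_top,
    (closure W).measure_eq_iInf_isOpen]
  refine le_iInf₂ fun U hWU => le_iInf fun hU => ?_
  obtain ⟨V, hV, hWV⟩ := compact_open_separated_add_right hW hU hWU
  obtain ⟨C, hC, hCV⟩ := h.exists_isCompact_isCovering_prod hV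
  have hC_nonempty : C.Nonempty := let ⟨_, hγ⟩ := hCV 0; ⟨_, hγ.1⟩
  have hlim := ENNReal.Tendsto.mul_const (b := mH U) (hF.tendsto_thickening C hC hC_nonempty)
    (Or.inl one_ne_zero)
  rw [one_mul] at hlim
  refine (limsup_le_limsup (Eventually.of_forall fun i => ?_)).trans_eq hlim.limsup_eq
  exact h.covol_mul_pointFrequency_le hCV hC ((add_subset_add_right subset_closure).trans hWV)
    hU.measurableSet (hF.isCompact i)

theorem le_liminf_pointFrequency [l.NeBot] (h : IsCutAndProjectScheme mG mH Γ)
    (hF : IsAdaptedFolner mG l F) (W : Set H) :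
    (covol mG mH Γ)⁻¹ * mH (interior W) ≤
      liminf (fun i => pointFrequency mG (cutAndProjectSet Γ W) (F i)) l := by
  rw [ENNReal.inv_mul_le_iff h.covol_ne_zero h.covol_ne_top,
    ← ENNReal.liminf_const_mul_of_ne_top h.covol_ne_top,
    isOpen_interior.measure_eq_iSup_isCompact]
  refine iSup₂_le fun K hKW => iSup_le fun hK => ?_
  obtain ⟨V, hV, hKV⟩ := compact_open_separated_add_right hK isOpen_interior hKW
  obtain ⟨C, hC, hCV⟩ := h.exists_isCompact_isCovering_prod hV
  have hC_nonempty : C.Nonempty := let ⟨_, hγ⟩ := hCV 0; ⟨_, hγ.1⟩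
  have hlim := ENNReal.Tendsto.mul_const (b := mH K)
    (hF.tendsto_measure_erosion_div hC hC_nonempty) (Or.inl one_ne_zero)
  rw [one_mul] at hlim
  refine hlim.liminf_eq.symm.trans_le (liminf_le_liminf (Eventually.of_forall fun i => ?_))
  exact h.le_covol_mul_pointFrequency hCV (hKV.trans interior_subset) hK.measurableSet
    (hF.isCompact i).isClosed

theorem tendsto_pointFrequency [l.NeBot] (h : IsCutAndProjectScheme mG mH Γ)
    (hF : IsAdaptedFolner mG l F) (hWc : IsCompact (closure W)) (hW : IsJordanMeasurable mH W) :
    Tendsto (fun i => pointFrequency mG (cutAndProjectSet Γ W) (F i)) l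
      (𝓝 ((covol mG mH Γ)⁻¹ * mH W)) := by
  refine tendsto_of_le_liminf_of_limsup_le ?_ ?_
  · rw [← measure_interior_of_null_frontier hW]
    exact h.le_liminf_pointFrequency hF W
  · rw [← measure_closure_of_null_frontier hW]
    exact h.limsup_pointFrequency_le hF hWc

theorem limsup_pointFrequency_sub_le [l.NeBot] (h : IsCutAndProjectScheme mG mH Γ)
    (hF : IsAdaptedFolner mG l F) (hW : IsCompact (closure W)) :
    limsup (fun i =>
        pointFrequency mG (cutAndProjectSet Γ W - cutAndProjectSet Γ W) (F i)) l ≤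
      (covol mG mH Γ)⁻¹ * mH (closure (W - W)) := by
  have hWW : IsCompact (closure W - closure W) := by
    simpa only [sub_eq_add_neg] using hW.add hW.neg
  refine (limsup_le_limsup (Eventually.of_forall fun i =>
    pointFrequency_mono (cutAndProjectSet_sub_subset W W) (F i))).trans ?_
  exact h.limsup_pointFrequency_le hF
    (hWW.closure_of_subset (sub_subset_sub subset_closure subset_closure))

theorem le_liminf_pointFrequency_sub [l.NeBot] (h : IsCutAndProjectScheme mG mH Γ)
    (hF : IsAdaptedFolner mG l F) (W : Set H) :
    (covol mG mH Γ)⁻¹ * mH (interior W - interior W) ≤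
      liminf (fun i =>
        pointFrequency mG (cutAndProjectSet Γ W - cutAndProjectSet Γ W) (F i)) l := by
  have hP : cutAndProjectSet Γ (interior W - interior W) ⊆
      cutAndProjectSet Γ W - cutAndProjectSet Γ W :=
    (cutAndProjectSet_sub_subset_sub h.dense isOpen_interior isOpen_interior).trans
      (sub_subset_sub (cutAndProjectSet_mono interior_subset)
        (cutAndProjectSet_mono interior_subset))
  have hopen : IsOpen (interior W - interior W) := isOpen_interior.sub_right
  nth_rewrite 1 [← hopen.interior_eq]
  exact (h.le_liminf_pointFrequency hF _).trans
    (liminf_le_liminf (Eventually.of_forall fun i => pointFrequency_mono hP (F i)))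

end IsCutAndProjectScheme

end Density

section Ball

open Metric

variable {E : Type*} [NormedAddCommGroup E] [NormedSpace ℝ E] [FiniteDimensional ℝ E]
  [MeasurableSpace E] [BorelSpace E] (μ : Measure E) [μ.IsAddHaarMeasure] (x : E) {r : ℝ}

lemma isJordanMeasurable_closedBall (hr : r ≠ 0) : IsJordanMeasurable μ (closedBall x r) := by
  rw [IsJordanMeasurable, frontier_closedBall x hr]
  exact Measure.addHaar_sphere_of_ne_zero μ x hr

lemma measure_closedBall_sub_closedBall (hr : 0 ≤ r) :
    μ (closedBall x r - closedBall x r) = 2 ^ Module.finrank ℝ E * μ (closedBall x r) := by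
  rw [closedBall_sub_closedBall hr hr, ← two_mul, Measure.addHaar_closedBall_mul μ _ zero_le_two hr,
    ENNReal.ofReal_pow zero_le_two, ENNReal.ofReal_ofNat, Measure.addHaar_closedBall_center μ x]

lemma measure_ball_sub_ball (hr : 0 < r) :
    μ (ball x r - ball x r) = 2 ^ Module.finrank ℝ E * μ (closedBall x r) := by
  have hrr : r + r ≠ 0 := (add_pos hr hr).ne'
  rw [← measure_closedBall_sub_closedBall μ x hr.le, ball_sub_ball hr hr,
    closedBall_sub_closedBall hr.le hr.le, ← interior_closedBall _ hrr]
  exact measure_interior_of_null_frontier (isJordanMeasurable_closedBall μ _ hrr)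

theorem IsCutAndProjectScheme.tendsto_pointFrequency_closedBall_sub {G ι : Type*} [AddCommGroup G]
    [TopologicalSpace G] [IsTopologicalAddGroup G] [T2Space G] [LocallyCompactSpace G]
    [SecondCountableTopology G] [MeasurableSpace G] [BorelSpace G] {mG : Measure G}
    [mG.IsAddHaarMeasure] {Γ : AddSubgroup (G × E)} {l : Filter ι} [l.NeBot] {F : ι → Set G}
    (h : IsCutAndProjectScheme mG μ Γ) (hF : IsAdaptedFolner mG l F) (hr : 0 < r) :
    Tendsto (fun i => pointFrequency mG
        (cutAndProjectSet Γ (closedBall x r) - cutAndProjectSet Γ (closedBall x r)) (F i)) l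
      (𝓝 (2 ^ Module.finrank ℝ E * ((covol mG μ Γ)⁻¹ * μ (closedBall x r)))) := by
  have hclosed : IsClosed (closedBall x r - closedBall x r) := by
    rw [closedBall_sub_closedBall hr.le hr.le]
    exact isClosed_closedBall
  rw [mul_left_comm]
  refine tendsto_of_le_liminf_of_limsup_le ?_ ?_
  · rw [← measure_ball_sub_ball μ x hr, ← interior_closedBall x hr.ne']
    exact h.le_liminf_pointFrequency_sub hF _
  · rw [← measure_closedBall_sub_closedBall μ x hr.le, ← hclosed.closure_eq]
    exact h.limsup_pointFrequency_sub_le hF (isCompact_closedBall x r).closure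

end Ball

open Metric in
theorem mainTheorem6_general {G ι : Type*} [AddCommGroup G] [TopologicalSpace G]
    [IsTopologicalAddGroup G] [T2Space G] [LocallyCompactSpace G] [SecondCountableTopology G]
    [MeasurableSpace G] [BorelSpace G] {mG : Measure G} [mG.IsAddHaarMeasure] {l : Filter ι}
    [l.NeBot] {F : ι → Set G} (hF : IsAdaptedFolner mG l F) :
    (∀ {H : Type v} [AddCommGroup H] [TopologicalSpace H] [IsTopologicalAddGroup H] [T2Space H]
      [LocallyCompactSpace H] [SecondCountableTopology H] [MeasurableSpace H] [BorelSpace H]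
      {mH : Measure H} [mH.IsAddHaarMeasure] {Γ : AddSubgroup (G × H)} {W : Set H},
      IsCutAndProjectScheme mG mH Γ → IsCompact (closure W) → IsJordanMeasurable mH W →
      IsJordanMeasurable mH (W - W) →
        Tendsto (fun i => pointFrequency mG (cutAndProjectSet Γ W) (F i)) l
          (𝓝 ((covol mG mH Γ)⁻¹ * mH W)) ∧
        (covol mG mH Γ)⁻¹ * mH (interior W - interior W) ≤ liminf (fun i =>
          pointFrequency mG (cutAndProjectSet Γ W - cutAndProjectSet Γ W) (F i)) l ∧
        limsup (fun i =>
          pointFrequency mG (cutAndProjectSet Γ W - cutAndProjectSet Γ W) (F i)) l ≤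
            (covol mG mH Γ)⁻¹ * mH (W - W)) ∧
    (∀ {E : Type w} [NormedAddCommGroup E] [NormedSpace ℝ E] [FiniteDimensional ℝ E]
      [MeasurableSpace E] [BorelSpace E] {mE : Measure E} [mE.IsAddHaarMeasure]
      {Γ : AddSubgroup (G × E)} (x : E) {r : ℝ}, IsCutAndProjectScheme mG mE Γ → 0 < r →
        Tendsto (fun i => pointFrequency mG (cutAndProjectSet Γ (closedBall x r)) (F i)) l
          (𝓝 ((covol mG mE Γ)⁻¹ * mE (closedBall x r))) ∧
        Tendsto (fun i => pointFrequency mG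
            (cutAndProjectSet Γ (closedBall x r) - cutAndProjectSet Γ (closedBall x r)) (F i)) l
          (𝓝 (2 ^ Module.finrank ℝ E * ((covol mG mE Γ)⁻¹ * mE (closedBall x r))))) := by
  refine ⟨fun h hWc hW hWW => ⟨h.tendsto_pointFrequency hF hWc hW,
    h.le_liminf_pointFrequency_sub hF _, ?_⟩, fun x r h hr => ⟨?_, ?_⟩⟩
  · rw [← measure_closure_of_null_frontier hWW]
    exact h.limsup_pointFrequency_sub_le hF hWc
  · exact h.tendsto_pointFrequency hF (isCompact_closedBall x r).closure
      (isJordanMeasurable_closedBall _ x hr.ne')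
  · exact h.tendsto_pointFrequency_closedBall_sub _ x hF hr

end CutProject

theorem mainTheorem6
    {G : Type u} [AddCommGroup G] [TopologicalSpace G] [IsTopologicalAddGroup G] [T2Space G]
    [LocallyCompactSpace G] [SecondCountableTopology G] [MeasurableSpace G] [BorelSpace G]
    (mG : Measure G) [mG.IsAddHaarMeasure] :
    -- the densities of `P` and `P - P` for a general abelian cut-and-project scheme
    (∀ (H : Type v) [AddCommGroup H] [TopologicalSpace H] [IsTopologicalAddGroup H] [T2Space H]
      [LocallyCompactSpace H] [SecondCountableTopology H] [MeasurableSpace H] [BorelSpace H]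
      (mH : Measure H) [mH.IsAddHaarMeasure]
      (Γ : AddSubgroup (G × H)) (W : Set H),
      IsCutAndProjectScheme mG mH Γ → IsWindow mH W → IsJordanMeasurable mH (W - W) →
      ∀ F : ℕ → Set G, IsStrongFolner mG F →
        asymptoticDensity mG F (cutAndProjectSet Γ W) = (covol mG mH Γ)⁻¹ * mH W ∧
        (covol mG mH Γ)⁻¹ * mH (interior W - interior W) ≤
          asymptoticDensity mG F (cutAndProjectSet Γ W - cutAndProjectSet Γ W) ∧
        asymptoticDensity mG F (cutAndProjectSet Γ W - cutAndProjectSet Γ W) ≤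
          (covol mG mH Γ)⁻¹ * mH (W - W)) ∧
    -- the case where `H` is the real line and the window is a compact interval
    (∀ (mR : Measure ℝ) [mR.IsAddHaarMeasure] (Γ : AddSubgroup (G × ℝ)) (a b : ℝ),
      IsCutAndProjectScheme mG mR Γ → a < b →
      ∀ F : ℕ → Set G, IsStrongFolner mG F →
        asymptoticDensity mG F (cutAndProjectSet Γ (Icc a b) - cutAndProjectSet Γ (Icc a b)) =
          2 * (covol mG mR Γ)⁻¹ * mR (Icc a b) ∧
        asymptoticDensity mG F (cutAndProjectSet Γ (Icc a b) - cutAndProjectSet Γ (Icc a b)) =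
          2 * asymptoticDensity mG F (cutAndProjectSet Γ (Icc a b))) := by
  refine ⟨fun H _ _ _ _ _ _ _ _ mH _ Γ W h hW hWW F hF => ?_,
    fun mR _ Γ a b h hab F hF => ?_⟩
  · obtain ⟨hP, hlower, hupper⟩ :=
      (mainTheorem6_general.{v, 0} hF.isAdaptedFolner).1 h hW.relativelyCompact hW.jordan hWW
    exact ⟨hP.limsup_eq, hlower.trans liminf_le_limsup, hupper⟩
  · rw [Real.Icc_eq_closedBall]
    obtain ⟨hP, hPP⟩ := (mainTheorem6_general.{v, 0} hF.isAdaptedFolner).2 ((a + b) / 2) h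
      (half_pos (sub_pos.2 hab))
    rw [Module.finrank_self, pow_one] at hPP
    have hPP_density := hPP.limsup_eq
    exact ⟨hPP_density.trans (mul_assoc _ _ _).symm,
      hPP_density.trans (congrArg _ hP.limsup_eq.symm)⟩
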